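/- Let $E$ be a Polish space with Borel $\sigma$-algebra $\mathcal E$, and let $d$ be a metric on the set $E$ such that $d:E\times E\to[0,\infty)$ is continuous for the given topology of $E$ ($d$ need be neither complete nor compatible with that topology). Let $P(x,\mathrm dy)$ be a Markov transition kernel on $(E,\mathcal E)$. For a probability measure $\mu$ on $E$ let $\mathbb P_\mu$ denote the law on $E^{\infty}=E^{\{0,1,2,\dots\}}$ of the Markov chain with transition kernel $P$ and initial distribution $\mu$, and write $\mathbb P_x=\mathbb P_{\delta_x}$. A probability measure $\mu$ on $E$ is invariant if $\mu(\mathrm dy)=\int_E P(x,\mathrm dy)\,\mu(\mathrm dx)$; an invariant probability measure $\mu$ is ergodic if the left shift on $E^\infty$ is ergodic with respect to $\mathbb P_\mu$. For probability measures $\mathbb P,\mathbb Q$ on $E^\infty$ let $\widehat C(\mathbb P,\mathbb Q)$ be the set of all probability measures $\xi$ on $E^\infty\times E^\infty$ whose first and second marginals are absolutely continuous with respect to $\mathbb P$ and $\mathbb Q$, respectively; write $(X,Y)=((X_i)_{i\ge0},(Y_i)_{i\ge0})$ for the canonical element of $E^\infty\times E^\infty$. Let $M\in\mathcal E$ be such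 that $\mu(M)>0$ for every invariant probability measure $\mu$, and suppose that for all $x,y\in M$ there exists $\alpha_{x,y}>0$ such that for every $\varepsilon>0$ there exists $\xi^{\varepsilon}_{x,y}\in\widehat C(\mathbb P_x,\mathbb P_y)$ with $$\limsup_{n\to\infty}\frac1n\sum_{i=0}^{n-1}\xi^{\varepsilon}_{x,y}\big(d(X_i,Y_i)\le\varepsilon\big)\ \ge\ \alpha_{x,y}.$$ Then there exists at most one invariant probability measure, and if one exists, it is ergodic. -/

import Mathlib

open MeasureTheory ProbabilityTheory Filter

noncomputable section

namespace GenCoupling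

/-- `d` is a metric on the set `E` which is continuous (as a function on `E × E`) for the given
topology of `E`.  It need be neither complete nor compatible with that topology. -/
structure IsContinuousMetric {E : Type*} [TopologicalSpace E] (d : E → E → ℝ) : Prop where
  nonneg : ∀ x y, 0 ≤ d x y
  eq_zero_iff : ∀ x y, d x y = 0 ↔ x = y
  symm : ∀ x y, d x y = d y x
  triangle : ∀ x y z, d x z ≤ d x y + d y z
  continuous : Continuous (fun p : E × E => d p.1 p.2)

variable {E : Type*} [MeasurableSpace E]

/-- The law on the trajectory space `ℕ → E` of the Markov chain with transition kernel `P` and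
initial distribution `μ`: given the first `n + 1` states `X₀, …, Xₙ`, the next state is drawn from
`P(Xₙ, ·)`. -/
def chainLaw (P : Kernel E E) [IsMarkovKernel P] (μ : Measure E) : Measure (ℕ → E) :=
  Kernel.trajMeasure (X := fun _ : ℕ => E) μ
    (fun n : ℕ => P.comap
      (fun x : (i : Finset.Iic n) → E => x ⟨n, Finset.mem_Iic.2 le_rfl⟩)
      (measurable_pi_apply _))

/-- The left shift on the trajectory space. -/
def shift (ω : ℕ → E) : ℕ → E := fun n => ω (n + 1)

/-- `μ` is an invariant probability measure of the chain with transition kernel `P`. -/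
def IsInvariantProb (P : Kernel E E) (μ : Measure E) : Prop :=
  IsProbabilityMeasure μ ∧ Kernel.Invariant P μ

/-- The generalized couplings of `μ` and `ν`: probability measures on the product space whose
marginals are absolutely continuous with respect to `μ` and `ν`. -/
def generalizedCouplings {S : Type*} [MeasurableSpace S] (μ ν : Measure S) :
    Set (Measure (S × S)) :=
  {ξ | IsProbabilityMeasure ξ ∧ ξ.map Prod.fst ≪ μ ∧ ξ.map Prod.snd ≪ ν}

end GenCoupling

end

/-! Uniqueness. If two invariant probabilities differ, the normalised positive and negative parts of
their difference are again invariant and live on disjoint sets `H` and `Hᶜ`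
(`exists_mutuallySingular_invariant`); no ergodic decomposition is needed. For an invariant
probability carried by `S` and any `c > 0`, almost every starting point admits a compact `K ⊆ S`
outside which the chain almost surely spends upper frequency at most `c`
(`ae_exists_compact_lowFrequency`). Averaged over the starting point, this comes from inner
regularity and the maximal inequality; it holds for individual starting points because the frequency
event is shift-invariant and hence obeys a zero-one law (`ae_chainKernel_eq_zero_or_one`).

Both singular measures charge `M`, so such starting points `x`, `y` can be taken in `M`. The
compacts `K ⊆ H` and `L ⊆ Hᶜ` are at positive `d`-distance. Almost sure statements survive
absolutely continuous changes of marginals, so every generalized coupling is `ε`-close only with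
small average probability (`limsup_average_coupling_le`), against the assumed `α`.

Ergodicity. For shift-invariant `A`, restricting `μ` to the points from which `A` is almost sure
leaves it invariant (`invariant_restrict_chainKernel_eq_one`); by uniqueness the restriction is null
or, once normalised, equal to `μ`. -/

namespace GenCoupling

/-! ### Maximal ergodic theorem and maximal inequality -/

section MaximalErgodic

variable {Ω : Type*}

/-- The running maximum of the Birkhoff sums `0, f, f + f ∘ T, …` over at most `n` steps. -/
noncomputable def maxBirkhoffSum (T : Ω → Ω) (f : Ω → ℝ) : ℕ → Ω → ℝ
  | 0 => 0
  | n + 1 => fun ω => max 0 (f ω + maxBirkhoffSum T f n (T ω))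

theorem maxBirkhoffSum_nonneg (T : Ω → Ω) (f : Ω → ℝ) (n : ℕ) (ω : Ω) :
    0 ≤ maxBirkhoffSum T f n ω := by
  cases n with
  | zero => exact le_rfl
  | succ n => exact le_max_left _ _

theorem maxBirkhoffSum_le_succ (T : Ω → Ω) (f : Ω → ℝ) (n : ℕ) (ω : Ω) :
    maxBirkhoffSum T f n ω ≤ maxBirkhoffSum T f (n + 1) ω := by
  induction n generalizing ω with
  | zero => exact maxBirkhoffSum_nonneg T f 1 ω
  | succ n ih => exact max_le_max le_rfl (by linarith [ih (T ω)])

theorem birkhoffSum_le_maxBirkhoffSum (T : Ω → Ω) (f : Ω → ℝ) (n : ℕ) (ω : Ω) :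
    birkhoffSum T f n ω ≤ maxBirkhoffSum T f n ω := by
  induction n generalizing ω with
  | zero => simp [maxBirkhoffSum]
  | succ n ih =>
    rw [birkhoffSum_succ']
    exact le_trans (by linarith [ih (T ω)]) (le_max_right _ _)

theorem maxBirkhoffSum_le_mul {T : Ω → Ω} {f : Ω → ℝ} {C : ℝ} (hC : 0 ≤ C) (hf : ∀ ω, f ω ≤ C)
    (n : ℕ) (ω : Ω) : maxBirkhoffSum T f n ω ≤ n * C := by
  induction n generalizing ω with
  | zero => simp [maxBirkhoffSum]
  | succ n ih =>
    refine max_le (by positivity) ?_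
    push_cast
    linarith [ih (T ω), hf ω]

theorem measurable_maxBirkhoffSum [MeasurableSpace Ω] {T : Ω → Ω} {f : Ω → ℝ} (hT : Measurable T) (hf : Measurable f)
    (n : ℕ) : Measurable (maxBirkhoffSum T f n) := by
  induction n with
  | zero => exact measurable_const
  | succ n ih => exact measurable_const.max (hf.add (ih.comp hT))

/-- Garsia's argument: where the maximum `M n` is positive, `M n ≤ M (n + 1) = f + M n ∘ T`;
elsewhere `M n` vanishes and `M n ∘ T` is nonnegative. Integrating cancels the left side by
invariance. -/
theorem sub_comp_le_indicator_maxBirkhoffSum (T : Ω → Ω) (f : Ω → ℝ) (n : ℕ) (ω : Ω) :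
    maxBirkhoffSum T f n ω - maxBirkhoffSum T f n (T ω)
      ≤ {ω | 0 < maxBirkhoffSum T f n ω}.indicator f ω := by
  by_cases h : 0 < maxBirkhoffSum T f n ω
  · rw [Set.indicator_of_mem (by exact h)]
    have h1 := maxBirkhoffSum_le_succ T f n ω
    have h2 : maxBirkhoffSum T f (n + 1) ω = max 0 (f ω + maxBirkhoffSum T f n (T ω)) := rfl
    rcases max_choice 0 (f ω + maxBirkhoffSum T f n (T ω)) with h3 | h3 <;>
      rw [h3] at h2 <;> linarith
  · rw [Set.indicator_of_notMem (by exact h)]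
    linarith [maxBirkhoffSum_nonneg T f n (T ω)]

/-- The maximal ergodic theorem for bounded functions. -/
theorem setIntegral_maxBirkhoffSum_nonneg [MeasurableSpace Ω] {Q : Measure Ω}
    [IsProbabilityMeasure Q] {T : Ω → Ω}
    (hT : MeasurePreserving T Q Q) {f : Ω → ℝ} (hf : Measurable f) {C : ℝ}
    (hC : ∀ ω, |f ω| ≤ C) (n : ℕ) :
    0 ≤ ∫ ω in {ω | 0 < maxBirkhoffSum T f n ω}, f ω ∂Q := by
  have hm := measurable_maxBirkhoffSum hT.measurable hf n
  have hset : MeasurableSet {ω | 0 < maxBirkhoffSum T f n ω} :=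
    measurableSet_lt measurable_const hm
  have hint : Integrable f Q := Integrable.of_bound hf.aestronglyMeasurable C (ae_of_all _ hC)
  have hM : Integrable (maxBirkhoffSum T f n) Q := by
    refine Integrable.of_bound hm.aestronglyMeasurable (n * C) (ae_of_all _ fun ω => ?_)
    rw [Real.norm_of_nonneg (maxBirkhoffSum_nonneg T f n ω)]
    exact maxBirkhoffSum_le_mul ((abs_nonneg _).trans (hC ω))
      (fun ω => (le_abs_self _).trans (hC ω)) n ω
  have hMT : Integrable (fun ω => maxBirkhoffSum T f n (T ω)) Q :=
    hT.integrable_comp_of_integrable hM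
  have heq : ∫ ω, maxBirkhoffSum T f n (T ω) ∂Q = ∫ ω, maxBirkhoffSum T f n ω ∂Q := by
    have := integral_map (μ := Q) hT.measurable.aemeasurable
      (f := maxBirkhoffSum T f n) hm.aestronglyMeasurable
    rw [hT.map_eq] at this
    exact this.symm
  rw [← integral_indicator hset]
  calc (0 : ℝ) = ∫ ω, (maxBirkhoffSum T f n ω - maxBirkhoffSum T f n (T ω)) ∂Q := by
        rw [integral_sub hM hMT, heq, sub_self]
    _ ≤ _ := integral_mono (hM.sub hMT) (hint.indicator hset)
        (sub_comp_le_indicator_maxBirkhoffSum T f n)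

/-- The weak type maximal inequality for the frequency of visits to a set. -/
theorem mul_measureReal_frequency_gt_le [MeasurableSpace Ω] {Q : Measure Ω}
    [IsProbabilityMeasure Q] {T : Ω → Ω}
    (hT : MeasurePreserving T Q Q) {D : Set Ω} (hD : MeasurableSet D) {c : ℝ} (hc : 0 ≤ c) :
    c * Q.real {ω | ∃ n : ℕ, c * n < birkhoffSum T (D.indicator 1) n ω} ≤ Q.real D := by
  set f : Ω → ℝ := fun ω => D.indicator 1 ω - c with hfdef
  have hf : Measurable f := (measurable_one.indicator hD).sub measurable_const
  have hind (ω : Ω) : 0 ≤ D.indicator (1 : Ω → ℝ) ω ∧ D.indicator (1 : Ω → ℝ) ω ≤ 1 :=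
    ⟨Set.indicator_nonneg (fun _ _ => zero_le_one) _,
      Set.indicator_le' (fun _ _ => le_rfl) (fun _ _ => zero_le_one) ω⟩
  have hC (ω : Ω) : |f ω| ≤ 1 + c := by
    have := hind ω
    rw [abs_le]
    constructor <;> simp only [hfdef] <;> linarith
  have hsum (n : ℕ) (ω : Ω) :
      birkhoffSum T f n ω = birkhoffSum T (D.indicator 1) n ω - c * n := by
    simp [birkhoffSum, hfdef, Finset.sum_sub_distrib, mul_comm]
  let A : ℕ → Set Ω := fun n => {ω | 0 < maxBirkhoffSum T f n ω}
  have hAm (n : ℕ) : MeasurableSet (A n) :=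
    measurableSet_lt measurable_const (measurable_maxBirkhoffSum hT.measurable hf n)
  have hmono : Monotone A := monotone_nat_of_le_succ fun n ω hω =>
    lt_of_lt_of_le hω (maxBirkhoffSum_le_succ T f n ω)
  have hle (n : ℕ) : c * Q.real (A n) ≤ Q.real D := by
    have h0 := setIntegral_maxBirkhoffSum_nonneg hT hf hC n
    change 0 ≤ ∫ ω in A n, f ω ∂Q at h0
    have hi : Integrable (D.indicator (1 : Ω → ℝ)) Q :=
      (integrable_const (1 : ℝ)).indicator hD
    rw [hfdef, integral_sub hi.integrableOn (integrable_const _), integral_indicator_one hD,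
      setIntegral_const, smul_eq_mul, measureReal_restrict_apply hD] at h0
    have := measureReal_mono (μ := Q) (Set.inter_subset_left : D ∩ A n ⊆ D)
    linarith
  have hlim : Tendsto (fun n => c * Q.real (A n)) atTop (nhds (c * Q.real (⋃ n, A n))) := by
    refine Tendsto.const_mul c ?_
    exact (ENNReal.tendsto_toReal (measure_ne_top _ _)).comp
      (tendsto_measure_iUnion_atTop hmono)
  refine le_trans (mul_le_mul_of_nonneg_left (measureReal_mono ?_) hc)
    (le_of_tendsto' hlim hle)
  rintro ω ⟨n, hn⟩
  refine Set.mem_iUnion.2 ⟨n, ?_⟩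
  have := birkhoffSum_le_maxBirkhoffSum T f n ω
  rw [hsum] at this
  change 0 < maxBirkhoffSum T f n ω
  linarith

end MaximalErgodic

/-! ### Markov chain laws and the Markov property -/

section Chain

open Preorder

variable {E : Type*}

theorem shift_iterate_apply (n : ℕ) (ω : ℕ → E) (i : ℕ) : shift^[n] ω i = ω (i + n) := by
  induction n generalizing ω with
  | zero => rfl
  | succ n ih => rw [Function.iterate_succ_apply, ih]; simp [shift, add_assoc]

variable [MeasurableSpace E]

/-- The transition kernel of a Markov chain, as a kernel on the histories up to time `n`. -/
noncomputable abbrev historyKernel (P : Kernel E E) (n : ℕ) : Kernel (Finset.Iic n → E) E :=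
  P.comap (fun x : (i : Finset.Iic n) → E => x ⟨n, Finset.mem_Iic.2 le_rfl⟩)
    (measurable_pi_apply _)

/-- From time `n` on, the next state is drawn from `P` given the past. -/
def IsMarkovFrom (P : Kernel E E) (n : ℕ) (Q : Measure (ℕ → E)) : Prop :=
  ∀ a, n ≤ a → Q.map (frestrictLe (π := fun _ : ℕ => E) a) ⊗ₘ historyKernel P a =
    Q.map (fun x => (frestrictLe (π := fun _ : ℕ => E) a x, x (a + 1)))

theorem measurable_shift : Measurable (shift (E := E)) :=
  measurable_pi_lambda _ fun n => measurable_pi_apply (n + 1)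

theorem ext_of_map_frestrictLe {Q R : Measure (ℕ → E)} [IsProbabilityMeasure Q]
    [IsProbabilityMeasure R]
    (h : ∀ n, Q.map (frestrictLe (π := fun _ : ℕ => E) n) = R.map (frestrictLe n)) : Q = R := by
  refine ext_of_generate_finite (measurableCylinders fun _ : ℕ => E)
    generateFrom_measurableCylinders.symm isPiSystem_measurableCylinders (fun t ht => ?_) (by simp)
  obtain ⟨N, S, mS, rfl⟩ : ∃ N S, MeasurableSet S ∧ t = cylinder (Finset.Iic N) S := by
    simpa [measurableCylinders_nat] using ht
  have := congrArg (fun ρ => ρ S) (h N)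
  simp only at this
  rwa [Measure.map_apply (measurable_frestrictLe N) mS,
    Measure.map_apply (measurable_frestrictLe N) mS] at this

/-- Append one more state to a history. -/
def snocHistory (a : ℕ) (p : (Finset.Iic a → E) × E) (i : Finset.Iic (a + 1)) : E :=
  if h : (i : ℕ) ≤ a then p.1 ⟨i, Finset.mem_Iic.2 h⟩ else p.2

theorem measurable_snocHistory (a : ℕ) : Measurable (snocHistory (E := E) a) := by
  refine measurable_pi_lambda _ fun i => ?_
  unfold snocHistory
  split_ifs <;> fun_prop

/-- Initial law and transitions determine all finite-dimensional laws, by induction on the time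
horizon. Every identification of trajectory laws under the shift goes through this. -/
theorem IsMarkovFrom.ext {P : Kernel E E} {Q R : Measure (ℕ → E)}
    [IsProbabilityMeasure Q] [IsProbabilityMeasure R] (hQ : IsMarkovFrom P 0 Q)
    (hR : IsMarkovFrom P 0 R) (h0 : Q.map (fun x => x 0) = R.map (fun x => x 0)) : Q = R := by
  refine ext_of_map_frestrictLe fun n => ?_
  induction n with
  | zero =>
    have hm : Measurable (fun (x : E) (_ : Finset.Iic 0) => x) := by fun_prop
    have : (frestrictLe (π := fun _ : ℕ => E) 0)
        = (fun (x : E) (_ : Finset.Iic 0) => x) ∘ (fun x : ℕ → E => x 0) := by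
      ext x i
      have : (i : ℕ) = 0 := Nat.le_zero.1 (Finset.mem_Iic.1 i.2)
      simp [this]
    rw [this, ← Measure.map_map hm (by fun_prop), ← Measure.map_map hm (by fun_prop), h0]
  | succ a ih =>
    have : (frestrictLe (π := fun _ : ℕ => E) (a + 1)) =
        snocHistory a ∘ (fun x => (frestrictLe (π := fun _ : ℕ => E) a x, x (a + 1))) := by
      ext x i
      have := Finset.mem_Iic.1 i.2
      by_cases h : (i : ℕ) ≤ a
      · simp [snocHistory, h]
      · have h' : (i : ℕ) = a + 1 := by omega
        simp [snocHistory, h']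
    rw [this, ← Measure.map_map (measurable_snocHistory a) (by fun_prop),
      ← Measure.map_map (measurable_snocHistory a) (by fun_prop), ← hQ a (Nat.zero_le _),
      ← hR a (Nat.zero_le _), ih]

theorem compProd_comap_map {X Y Z : Type*} [MeasurableSpace X] [MeasurableSpace Y]
    [MeasurableSpace Z] (ρ : Measure X) [IsFiniteMeasure ρ] (κ : Kernel Y Z) [IsMarkovKernel κ]
    {g : X → Y} (hg : Measurable g) :
    (ρ ⊗ₘ κ.comap g hg).map (Prod.map g id) = ρ.map g ⊗ₘ κ := by
  ext s hs
  rw [Measure.map_apply (by fun_prop) hs, Measure.compProd_apply (hs.preimage (by fun_prop)),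
    Measure.compProd_apply hs, lintegral_map (Kernel.measurable_kernel_prodMk_left hs) hg]
  rfl

/-- The transition depends on the history only through its last state, so it factors through the map
`g` that forgets the first `n` states. -/
theorem IsMarkovFrom.map_shift_iterate {P : Kernel E E} [IsMarkovKernel P] {n : ℕ}
    {Q : Measure (ℕ → E)} [IsProbabilityMeasure Q] (hQ : IsMarkovFrom P n Q) :
    IsMarkovFrom P 0 (Q.map (shift^[n])) := by
  intro a _
  let g : (Finset.Iic (a + n) → E) → Finset.Iic a → E :=
    fun y i => y ⟨i + n, Finset.mem_Iic.2 (Nat.add_le_add_right (Finset.mem_Iic.1 i.2) n)⟩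
  have hg : Measurable g := measurable_pi_lambda _ fun i => measurable_pi_apply _
  have hs : Measurable (shift (E := E))^[n] := measurable_shift.iterate n
  have h1 : (frestrictLe (π := fun _ : ℕ => E) a) ∘ shift^[n] = g ∘ frestrictLe (a + n) := by
    ext x i
    simp [g, shift_iterate_apply]
  have h2 : (fun x : ℕ → E => (frestrictLe (π := fun _ : ℕ => E) a x, x (a + 1))) ∘ shift^[n] =
      Prod.map g id ∘ (fun x => (frestrictLe (π := fun _ : ℕ => E) (a + n) x, x (a + n + 1))) := by
    ext x i
    · exact congrFun (congrFun h1 x) i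
    · simp [shift_iterate_apply, add_right_comm]
  rw [Measure.map_map (by fun_prop) hs, Measure.map_map (by fun_prop) hs, h1, h2,
    ← Measure.map_map hg (by fun_prop), ← Measure.map_map (by fun_prop) (by fun_prop),
    ← hQ (a + n) (Nat.le_add_left _ _)]
  have := Measure.isProbabilityMeasure_map (μ := Q)
    (measurable_frestrictLe (X := fun _ : ℕ => E) (a + n)).aemeasurable
  exact (compProd_comap_map _ (historyKernel P a) hg).symm

variable (P : Kernel E E) [IsMarkovKernel P]

instance (μ : Measure E) [IsProbabilityMeasure μ] : IsProbabilityMeasure (chainLaw P μ) := by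
  unfold chainLaw; infer_instance

theorem isMarkovFrom_chainLaw (μ : Measure E) [IsProbabilityMeasure μ] :
    IsMarkovFrom P 0 (chainLaw P μ) := fun _ _ =>
  Kernel.map_frestrictLe_trajMeasure_compProd_eq_map_trajMeasure

theorem isMarkovFrom_traj (n : ℕ) (x : Finset.Iic n → E) :
    IsMarkovFrom P n (Kernel.traj (X := fun _ : ℕ => E) (historyKernel P) n x) := fun a ha => by
  rw [Kernel.traj_map_frestrictLe_apply]
  exact Kernel.partialTraj_compProd_eq_map_traj ha

theorem map_frestrictLe_traj_self (n : ℕ) (x : Finset.Iic n → E) :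
    (Kernel.traj (X := fun _ : ℕ => E) (historyKernel P) n x).map (frestrictLe n)
      = Measure.dirac x := by
  rw [Kernel.traj_map_frestrictLe_apply, Kernel.partialTraj_self, Kernel.id_apply]

/-- The chain started at a point, as a kernel. -/
noncomputable def chainKernel : Kernel E (ℕ → E) :=
  (Kernel.traj (X := fun _ : ℕ => E) (historyKernel P) 0).comap
    (MeasurableEquiv.piUnique fun _ : Finset.Iic 0 => E).symm (MeasurableEquiv.measurable _)

instance : IsMarkovKernel (chainKernel P) := by unfold chainKernel; infer_instance

theorem chainLaw_eq_bind (μ : Measure E) : chainLaw P μ = μ.bind (chainKernel P) := by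
  unfold chainLaw Kernel.trajMeasure
  ext s hs
  rw [Measure.bind_apply hs (Kernel.aemeasurable _), Measure.bind_apply hs (Kernel.aemeasurable _),
    lintegral_map (Kernel.measurable_coe _ hs) (MeasurableEquiv.measurable _)]
  rfl

theorem chainLaw_dirac (x : E) : chainLaw P (Measure.dirac x) = chainKernel P x := by
  rw [chainLaw_eq_bind, Measure.dirac_bind (Kernel.measurable _)]

theorem map_eval_zero_chainKernel (x : E) :
    (chainKernel P x).map (fun ω => ω 0) = Measure.dirac x := by
  have h := congrArg (Measure.map fun y : Finset.Iic 0 → E => y ⟨0, Finset.mem_Iic.2 le_rfl⟩)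
    (map_frestrictLe_traj_self P 0 ((MeasurableEquiv.piUnique fun _ : Finset.Iic 0 => E).symm x))
  rw [Measure.map_map (by fun_prop) (by fun_prop), Measure.map_dirac' (by fun_prop)] at h
  exact h

theorem map_eval_zero_chainLaw (μ : Measure E) [IsProbabilityMeasure μ] :
    (chainLaw P μ).map (fun ω => ω 0) = μ := by
  rw [chainLaw_eq_bind, Measure.map_comp _ _ (by fun_prop)]
  have : (chainKernel P).map (fun ω => ω 0) = Kernel.id := by
    ext1 x
    rw [Kernel.map_apply _ (by fun_prop), map_eval_zero_chainKernel, Kernel.id_apply]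
  rw [this, Measure.id_comp]

/-- The Markov property at time `n` on the level of trajectory laws. -/
theorem map_shift_iterate_traj (n : ℕ) (x : Finset.Iic n → E) :
    (Kernel.traj (X := fun _ : ℕ => E) (historyKernel P) n x).map (shift^[n])
      = chainKernel P (x ⟨n, Finset.mem_Iic.2 le_rfl⟩) := by
  have hs : Measurable (shift (E := E))^[n] := measurable_shift.iterate n
  have := Measure.isProbabilityMeasure_map
    (μ := Kernel.traj (X := fun _ : ℕ => E) (historyKernel P) n x) hs.aemeasurable
  rw [← chainLaw_dirac]
  refine (isMarkovFrom_traj P n x).map_shift_iterate.ext (isMarkovFrom_chainLaw P _) ?_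
  rw [map_eval_zero_chainLaw, Measure.map_map (by fun_prop) hs]
  have h := congrArg (Measure.map fun y : Finset.Iic n → E => y ⟨n, Finset.mem_Iic.2 le_rfl⟩)
    (map_frestrictLe_traj_self P n x)
  rw [Measure.map_map (by fun_prop) (by fun_prop), Measure.map_dirac' (by fun_prop)] at h
  rw [← h]
  congr 1
  ext ω
  simp [shift_iterate_apply]

theorem map_eval_one_chainLaw (μ : Measure E) [IsProbabilityMeasure μ] :
    (chainLaw P μ).map (fun ω => ω 1) = μ.bind P := by
  have h := congrArg Measure.snd (isMarkovFrom_chainLaw P μ 0 le_rfl)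
  rw [Measure.snd_compProd, Measure.snd, Measure.map_map (by fun_prop) (by fun_prop)] at h
  change _ = (chainLaw P μ).map (fun ω => ω 1) at h
  rw [← h]
  conv_rhs => rw [← map_eval_zero_chainLaw P μ]
  ext s hs
  rw [Measure.bind_apply hs (Kernel.aemeasurable _), Measure.bind_apply hs (Kernel.aemeasurable _),
    lintegral_map (Kernel.measurable_coe _ hs) (by fun_prop),
    lintegral_map (Kernel.measurable_coe _ hs) (by fun_prop)]
  rfl

theorem map_shift_chainLaw (μ : Measure E) [IsProbabilityMeasure μ] :
    (chainLaw P μ).map shift = chainLaw P (μ.bind P) := by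
  have := Measure.isProbabilityMeasure_map (μ := chainLaw P μ) measurable_shift.aemeasurable
  have hQ : IsMarkovFrom P 1 (chainLaw P μ) := fun a _ => isMarkovFrom_chainLaw P μ a (Nat.zero_le _)
  refine IsMarkovFrom.ext (P := P) hQ.map_shift_iterate (isMarkovFrom_chainLaw P _) ?_
  rw [map_eval_zero_chainLaw, Measure.map_map (by fun_prop) measurable_shift,
    ← map_eval_one_chainLaw]
  rfl

theorem measurePreserving_shift {μ : Measure E} (hμ : IsInvariantProb P μ) :
    MeasurePreserving shift (chainLaw P μ) (chainLaw P μ) := by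
  have := hμ.1
  exact ⟨measurable_shift, by rw [map_shift_chainLaw, hμ.2]⟩

theorem chainLaw_apply (μ : Measure E) {A : Set (ℕ → E)} (hA : MeasurableSet A) :
    chainLaw P μ A = ∫⁻ x, chainKernel P x A ∂μ := by
  rw [chainLaw_eq_bind, Measure.bind_apply hA (Kernel.aemeasurable _)]

/-- The probability of a shift-invariant event is a harmonic function of the starting point. -/
theorem lintegral_chainKernel_of_shift_invariant {A : Set (ℕ → E)} (hA : MeasurableSet A)
    (hinv : shift ⁻¹' A = A) (x : E) :
    ∫⁻ y, chainKernel P y A ∂(P x) = chainKernel P x A := by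
  have h := congrArg (fun ρ => ρ A) (map_shift_chainLaw P (Measure.dirac x))
  rw [Measure.map_apply measurable_shift hA, hinv, Measure.dirac_bind (Kernel.measurable _),
    chainLaw_dirac, chainLaw_apply P (P x) hA] at h
  exact h.symm

end Chain

/-! ### Zero-one law for shift-invariant events -/

section ZeroOne

open Preorder

variable {E : Type*}

theorem preimage_shift_iterate {A : Set (ℕ → E)} (hinv : shift ⁻¹' A = A) (n : ℕ) :
    shift^[n] ⁻¹' A = A := by
  induction n with
  | zero => rfl
  | succ n ih => rw [Function.iterate_succ, Set.preimage_comp, ih, hinv]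

variable [MeasurableSpace E]

theorem iSup_piLE_eq : (⨆ n, Filtration.piLE (X := fun _ : ℕ => E) n) = MeasurableSpace.pi := by
  refine le_antisymm (iSup_le fun n => Filtration.piLE.le n) ?_
  refine iSup_le fun i => le_trans ?_ (le_iSup _ i)
  rw [Filtration.piLE_eq_comap_frestrictLe]
  have : (fun ω : ℕ → E => ω i) =
      (fun y : Finset.Iic i → E => y ⟨i, Finset.mem_Iic.2 le_rfl⟩) ∘ frestrictLe i := rfl
  rw [this, ← MeasurableSpace.comap_comp]
  exact MeasurableSpace.comap_mono (measurable_pi_apply _).comap_le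

variable (P : Kernel E E) [IsMarkovKernel P]

theorem traj_apply_of_shift_invariant {A : Set (ℕ → E)} (hA : MeasurableSet A)
    (hinv : shift ⁻¹' A = A) (n : ℕ) (x : Finset.Iic n → E) :
    Kernel.traj (X := fun _ : ℕ => E) (historyKernel P) n x A
      = chainKernel P (x ⟨n, Finset.mem_Iic.2 le_rfl⟩) A := by
  rw [← map_shift_iterate_traj, Measure.map_apply (measurable_shift.iterate n) hA,
    preimage_shift_iterate hinv]

theorem measurable_chainKernel_real {A : Set (ℕ → E)} (hA : MeasurableSet A) :
    Measurable fun x => (chainKernel P x).real A :=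
  (Kernel.measurable_coe _ hA).ennreal_toReal

theorem ae_tendsto_traj {A : Set (ℕ → E)} (hA : MeasurableSet A)
    (hinv : shift ⁻¹' A = A) (x : Finset.Iic 0 → E) :
    ∀ᵐ ω ∂(Kernel.traj (X := fun _ : ℕ => E) (historyKernel P) 0 x),
      Tendsto (fun n => (chainKernel P (ω n)).real A) atTop (nhds (A.indicator 1 ω)) := by
  have hint : Integrable (A.indicator (1 : (ℕ → E) → ℝ))
      (Kernel.traj (X := fun _ : ℕ => E) (historyKernel P) 0 x) :=
    (integrable_const (1 : ℝ)).indicator hA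
  have hmeas : StronglyMeasurable[⨆ n, Filtration.piLE (X := fun _ : ℕ => E) n]
      (A.indicator (1 : (ℕ → E) → ℝ)) := by
    rw [iSup_piLE_eq]
    exact (measurable_one.indicator hA).stronglyMeasurable
  have hlevy := hint.tendsto_ae_condExp hmeas
  have hcond := ae_all_iff.2 fun n : ℕ =>
    Kernel.condExp_traj (X := fun _ : ℕ => E) (κ := historyKernel P) (Nat.zero_le n) hint
  filter_upwards [hlevy, hcond] with ω h1 h2
  refine h1.congr fun n => ?_
  rw [h2 n, integral_indicator_one hA, measureReal_def, traj_apply_of_shift_invariant P hA hinv,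
    measureReal_def, frestrictLe_apply]

/-- Lévy's zero-one law for shift-invariant events. -/
theorem ae_tendsto_chainKernel_real {A : Set (ℕ → E)} (hA : MeasurableSet A)
    (hinv : shift ⁻¹' A = A) (x : E) :
    ∀ᵐ ω ∂(chainKernel P x), Tendsto (fun n => (chainKernel P (ω n)).real A) atTop
      (nhds (A.indicator 1 ω)) := by
  have := ae_tendsto_traj P hA hinv ((MeasurableEquiv.piUnique fun _ : Finset.Iic 0 => E).symm x)
  rwa [← Kernel.comap_apply (Kernel.traj (X := fun _ : ℕ => E) (historyKernel P) 0)
    (MeasurableEquiv.measurable _) x] at this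

/-- Lévy's law sends `ψ ∘ shift^[n]` to `0` almost surely, while stationarity keeps its integral
independent of `n`. Hence `ψ` itself has integral zero. -/
theorem ae_chainLaw_indicator_eq {μ : Measure E} (hμ : IsInvariantProb P μ) {A : Set (ℕ → E)}
    (hA : MeasurableSet A) (hinv : shift ⁻¹' A = A) :
    ∀ᵐ ω ∂(chainLaw P μ), (chainKernel P (ω 0)).real A = A.indicator 1 ω := by
  have := hμ.1
  have hf := measurable_chainKernel_real P hA
  have hi : Measurable (A.indicator (1 : (ℕ → E) → ℝ)) := measurable_one.indicator hA
  let ψ : (ℕ → E) → ℝ := fun ω => |(chainKernel P (ω 0)).real A - A.indicator 1 ω|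
  have hψ : Measurable ψ := by
    have : Measurable fun ω : ℕ → E => (chainKernel P (ω 0)).real A - A.indicator 1 ω :=
      (hf.comp (measurable_pi_apply 0)).sub hi
    exact this.norm
  have hind (ω : ℕ → E) : 0 ≤ A.indicator (1 : (ℕ → E) → ℝ) ω ∧ A.indicator 1 ω ≤ (1 : ℝ) :=
    ⟨Set.indicator_nonneg (fun _ _ => zero_le_one) _,
      Set.indicator_le' (fun _ _ => le_rfl) (fun _ _ => zero_le_one) ω⟩
  have hbound (ω : ℕ → E) : ‖ψ ω‖ ≤ 1 := by
    have h1 := hind ω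
    have h2 : 0 ≤ (chainKernel P (ω 0)).real A := measureReal_nonneg
    have h3 : (chainKernel P (ω 0)).real A ≤ 1 := measureReal_le_one
    simp only [ψ, norm_abs_eq_norm, Real.norm_eq_abs, abs_le]
    constructor <;> linarith
  have hψn (n : ℕ) (ω : ℕ → E) :
      ψ (shift^[n] ω) = |(chainKernel P (ω n)).real A - A.indicator 1 ω| := by
    have : (A.indicator 1 (shift^[n] ω) : ℝ) = A.indicator 1 ω := by
      conv_rhs => rw [← preimage_shift_iterate hinv n]
      rfl
    simp only [ψ]
    rw [this, shift_iterate_apply, zero_add]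
  have hae : ∀ᵐ ω ∂(chainLaw P μ), Tendsto (fun n => ψ (shift^[n] ω)) atTop (nhds 0) := by
    rw [chainLaw_eq_bind]
    refine Measure.ae_comp_of_ae_ae ?_ (ae_of_all _ fun x => ?_)
    · exact measurableSet_tendsto _ fun n => hψ.comp (measurable_shift.iterate n)
    · filter_upwards [ae_tendsto_chainKernel_real P hA hinv x] with ω hω
      simp_rw [hψn]
      have := (hω.sub_const (A.indicator 1 ω)).abs
      simpa using this
  have hlim : Tendsto (fun n => ∫ ω, ψ (shift^[n] ω) ∂(chainLaw P μ)) atTop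
      (nhds (∫ _, (0 : ℝ) ∂(chainLaw P μ))) :=
    tendsto_integral_of_dominated_convergence (fun _ => 1)
      (fun n => (hψ.comp (measurable_shift.iterate n)).aestronglyMeasurable)
      (integrable_const _) (fun n => ae_of_all _ fun ω => hbound _) hae
  have hconst (n : ℕ) : ∫ ω, ψ (shift^[n] ω) ∂(chainLaw P μ) = ∫ ω, ψ ω ∂(chainLaw P μ) := by
    have hmp := (measurePreserving_shift P hμ).iterate n
    have := integral_map (μ := chainLaw P μ) hmp.measurable.aemeasurable
      (f := ψ) hψ.aestronglyMeasurable
    rw [hmp.map_eq] at this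
    exact this.symm
  simp_rw [hconst, integral_zero] at hlim
  have h0 := tendsto_nhds_unique hlim tendsto_const_nhds
  have hz := (integral_eq_zero_iff_of_nonneg (μ := chainLaw P μ) (f := ψ)
    (fun ω => abs_nonneg _)
    (Integrable.of_bound hψ.aestronglyMeasurable 1 (ae_of_all _ hbound))).1 (by simpa using h0.symm)
  filter_upwards [hz] with ω hω
  exact sub_eq_zero.1 (abs_eq_zero.1 hω)

/-- For an invariant initial law, a shift-invariant event has probability zero or one from almost
every starting point. -/
theorem ae_chainKernel_eq_zero_or_one {μ : Measure E} (hμ : IsInvariantProb P μ)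
    {A : Set (ℕ → E)} (hA : MeasurableSet A) (hinv : shift ⁻¹' A = A) :
    ∀ᵐ x ∂μ, chainKernel P x A = 0 ∨ chainKernel P x A = 1 := by
  have := hμ.1
  have hm := Kernel.measurable_coe (chainKernel P) hA
  have hset : MeasurableSet {x | chainKernel P x A = 0 ∨ chainKernel P x A = 1} :=
    (hm (measurableSet_singleton 0)).union (hm (measurableSet_singleton 1))
  have h0 : Measurable fun ω : ℕ → E => ω 0 := measurable_pi_apply 0
  rw [← map_eval_zero_chainLaw P μ, ae_map_iff h0.aemeasurable hset]
  filter_upwards [ae_chainLaw_indicator_eq P hμ hA hinv] with ω hω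
  by_cases h : ω ∈ A
  · right
    rw [Set.indicator_of_mem h, measureReal_def, Pi.one_apply] at hω
    rw [← ENNReal.ofReal_toReal (measure_ne_top (chainKernel P (ω 0)) A), hω, ENNReal.ofReal_one]
  · left
    rw [Set.indicator_of_notMem h] at hω
    exact (measureReal_eq_zero_iff).1 hω

/-- Restricting an invariant measure to the starting points from which a shift-invariant event is
almost sure gives an invariant measure. -/
theorem invariant_restrict_chainKernel_eq_one {μ : Measure E} (hμ : IsInvariantProb P μ)
    {A : Set (ℕ → E)} (hA : MeasurableSet A) (hinv : shift ⁻¹' A = A) :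
    (μ.restrict {x | chainKernel P x A = 1}).bind P = μ.restrict {x | chainKernel P x A = 1} := by
  have := hμ.1
  set B := {x | chainKernel P x A = 1}
  have hm := Kernel.measurable_coe (chainKernel P) hA
  have hB : MeasurableSet B := hm (measurableSet_singleton 1)
  -- A harmonic function with values in `[0, 1]` that equals `1` or `0` at `x` takes the same value
  -- `P x`-almost everywhere: neither `B` nor the zero set can be left.
  have hharm := lintegral_chainKernel_of_shift_invariant P hA hinv
  have hone (x : E) (hx : chainKernel P x A = 1) : ∀ᵐ y ∂(P x), y ∈ B := by
    have h1 : ∫⁻ y, chainKernel P y A ∂(P x) = ∫⁻ _, 1 ∂(P x) := by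
      rw [hharm, hx, lintegral_one, measure_univ]
    have := ae_eq_of_ae_le_of_lintegral_le (μ := P x) (f := fun y => chainKernel P y A)
      (g := fun _ => 1) (ae_of_all _ fun y => prob_le_one) (by rw [hharm]; exact measure_ne_top _ _)
      aemeasurable_const h1.ge
    filter_upwards [this] with y hy using hy
  have hzero (x : E) (hx : chainKernel P x A = 0) : ∀ᵐ y ∂(P x), y ∉ B := by
    have h1 : ∫⁻ y, chainKernel P y A ∂(P x) = 0 := by rw [hharm, hx]
    filter_upwards [(lintegral_eq_zero_iff hm).1 h1] with y hy hyB
    change chainKernel P y A = 1 at hyB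
    rw [hy] at hyB
    exact zero_ne_one hyB
  ext s hs
  rw [Measure.bind_apply hs (Kernel.aemeasurable _), Measure.restrict_apply hs,
    ← lintegral_indicator hB]
  conv_rhs => rw [← hμ.2.def, Measure.bind_apply (hs.inter hB) (Kernel.aemeasurable _)]
  refine lintegral_congr_ae ?_
  filter_upwards [ae_chainKernel_eq_zero_or_one P hμ hA hinv] with x hx
  rcases hx with hx | hx
  · have hxB : x ∉ B := fun h => zero_ne_one (hx.symm.trans h)
    rw [Set.indicator_of_notMem hxB]
    refine (measure_mono_null Set.inter_subset_right ?_).symm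
    have := hzero x hx
    rwa [ae_iff, show {a | ¬ a ∉ B} = B by ext; simp] at this
  · rw [Set.indicator_of_mem (show x ∈ B from hx)]
    refine measure_congr ?_
    filter_upwards [hone x hx] with y hy
    exact propext ⟨fun h => ⟨h, hy⟩, fun h => h.1⟩

end ZeroOne

/-! ### Singular invariant measures from two distinct ones -/

section Invariant

variable {E : Type*} [MeasurableSpace E]

theorem isInvariantProb_normalize {P : Kernel E E} {τ : Measure E} [IsFiniteMeasure τ] (h0 : τ ≠ 0)
    (hτ : τ.bind P = τ) : IsInvariantProb P ((τ Set.univ)⁻¹ • τ) := by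
  refine ⟨⟨?_⟩, ?_⟩
  · rw [Measure.smul_apply, smul_eq_mul]
    exact ENNReal.inv_mul_cancel (Measure.measure_univ_ne_zero.2 h0) (measure_ne_top _ _)
  · change ((τ Set.univ)⁻¹ • τ).bind P = _
    rw [Measure.comp_smul, hτ]

/-- The positive part of the difference of two invariant probability measures is invariant. -/
theorem bind_restrict_sub_restrict {P : Kernel E E} [IsMarkovKernel P] {μ ν : Measure E}
    (hμ : IsInvariantProb P μ) (hν : IsInvariantProb P ν) {H : Set E} (hH : MeasurableSet H)
    (hle : ν.restrict H ≤ μ.restrict H) (hge : μ.restrict Hᶜ ≤ ν.restrict Hᶜ) :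
    (μ.restrict H - ν.restrict H).bind P = μ.restrict H - ν.restrict H := by
  have := hμ.1
  have := hν.1
  set τ := μ.restrict H - ν.restrict H
  set κ := ν.restrict Hᶜ - μ.restrict Hᶜ
  have h1 : τ + ν.restrict H = μ.restrict H := Measure.sub_add_cancel_of_le hle
  have h2 : κ + μ.restrict Hᶜ = ν.restrict Hᶜ := Measure.sub_add_cancel_of_le hge
  -- Both sides are the supremum of `μ` and `ν`.
  have h3 : τ + ν = κ + μ := by
    calc τ + ν = (τ + ν.restrict H) + ν.restrict Hᶜ := by
          rw [add_assoc, Measure.restrict_add_restrict_compl hH]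
      _ = κ + (μ.restrict H + μ.restrict Hᶜ) := by rw [h1, ← h2]; abel
      _ = κ + μ := by rw [Measure.restrict_add_restrict_compl hH]
  have h4 : τ.bind P + ν = κ.bind P + μ := by
    have := congrArg (fun ρ : Measure E => ρ.bind P) h3
    simp only [Measure.comp_add] at this
    rwa [hμ.2.def, hν.2.def] at this
  have hτH : τ Hᶜ = 0 := by
    refine le_antisymm (le_trans (Measure.sub_le _) ?_) (zero_le)
    simp [Measure.restrict_apply hH.compl]
  -- On subsets of `H`, `h4` gives `τP + ν ≥ μ = τ + ν`, and the finite measure `ν` cancels. Since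
  -- `P` preserves total mass, the inequality then becomes equality.
  have hτle : τ ≤ τ.bind P := by
    refine Measure.le_iff.2 fun s hs => ?_
    have e1 : τ s = τ (s ∩ H) :=
      measure_congr (by
        filter_upwards [show ∀ᵐ x ∂τ, x ∈ H from hτH] with x hx
        exact propext ⟨fun h => ⟨h, hx⟩, fun h => h.1⟩)
    have e2 : τ (s ∩ H) + ν (s ∩ H) = μ (s ∩ H) := by
      have := congrArg (fun ρ : Measure E => ρ (s ∩ H)) h1
      simpa [Measure.restrict_apply (hs.inter hH), Set.inter_assoc] using this
    have e3 : (τ.bind P) (s ∩ H) + ν (s ∩ H) = (κ.bind P) (s ∩ H) + μ (s ∩ H) := by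
      have := congrArg (fun ρ : Measure E => ρ (s ∩ H)) h4
      simpa using this
    rw [e1]
    refine le_trans ?_ (measure_mono (Set.inter_subset_left (t := H)))
    refine (ENNReal.add_le_add_iff_right (measure_ne_top ν (s ∩ H))).1 ?_
    rw [e2, e3]
    exact le_add_self
  refine (Measure.eq_of_le_of_measure_univ_eq hτle ?_).symm
  rw [Measure.bind_apply .univ (Kernel.aemeasurable _)]
  simp

theorem exists_mutuallySingular_invariant {P : Kernel E E} [IsMarkovKernel P] {μ ν : Measure E}
    (hμ : IsInvariantProb P μ) (hν : IsInvariantProb P ν) (hne : μ ≠ ν) :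
    ∃ (σ ρ₂ : Measure E) (H : Set E), IsInvariantProb P σ ∧ IsInvariantProb P ρ₂ ∧
      MeasurableSet H ∧ σ Hᶜ = 0 ∧ ρ₂ H = 0 := by
  have := hμ.1
  have := hν.1
  obtain ⟨H, hH, h1, h2⟩ := hahn_decomposition μ ν
  have hle : ν.restrict H ≤ μ.restrict H := Measure.le_iff.2 fun s hs => by
    rw [Measure.restrict_apply hs, Measure.restrict_apply hs]
    exact h1 _ (hs.inter hH) Set.inter_subset_right
  have hge : μ.restrict Hᶜ ≤ ν.restrict Hᶜ := Measure.le_iff.2 fun s hs => by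
    rw [Measure.restrict_apply hs, Measure.restrict_apply hs]
    exact h2 _ (hs.inter hH.compl) Set.inter_subset_right
  have hτ := bind_restrict_sub_restrict hμ hν hH hle hge
  have hκ := bind_restrict_sub_restrict hν hμ hH.compl hge (by rwa [compl_compl])
  have hτH : (μ.restrict H - ν.restrict H) Hᶜ = 0 :=
    le_antisymm (le_trans (Measure.sub_le _) (by simp [Measure.restrict_apply hH.compl])) zero_le
  have hκH : (ν.restrict Hᶜ - μ.restrict Hᶜ) H = 0 :=
    le_antisymm (le_trans (Measure.sub_le _) (by simp [Measure.restrict_apply hH])) zero_le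
  have hτ0 : μ.restrict H - ν.restrict H ≠ 0 := fun h => hne (by
    have e := Measure.sub_add_cancel_of_le hle
    rw [h, zero_add] at e
    refine Measure.eq_of_le_of_measure_univ_eq ?_ (by simp)
    rw [← Measure.restrict_add_restrict_compl (μ := μ) hH,
      ← Measure.restrict_add_restrict_compl (μ := ν) hH, e]
    exact add_le_add le_rfl hge)
  have hκ0 : ν.restrict Hᶜ - μ.restrict Hᶜ ≠ 0 := fun h => hne (by
    have e := Measure.sub_add_cancel_of_le hge
    rw [h, zero_add] at e
    refine (Measure.eq_of_le_of_measure_univ_eq ?_ (by simp)).symm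
    rw [← Measure.restrict_add_restrict_compl (μ := μ) hH,
      ← Measure.restrict_add_restrict_compl (μ := ν) hH, e]
    exact add_le_add hle le_rfl)
  exact ⟨_, _, H, isInvariantProb_normalize hτ0 hτ, isInvariantProb_normalize hκ0 hκ, hH,
    by simp [hτH], by simp [hκH]⟩

end Invariant

/-! ### Visit frequencies and compact sets -/

section Frequency

variable {E : Type*}

/-- The number of visits to `D` before time `n`. -/
noncomputable def visits (D : Set E) (n : ℕ) (ω : ℕ → E) : ℝ :=
  ∑ i ∈ Finset.range n, D.indicator 1 (ω i)

/-- The trajectories whose upper asymptotic frequency of visits to `D` is at most `c`. -/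
def lowFrequency (D : Set E) (c : ℝ) : Set (ℕ → E) :=
  {ω | ∀ q : ℚ, c < q → ∀ᶠ n : ℕ in atTop, visits D n ω ≤ q * n}

theorem visits_eq_birkhoffSum (D : Set E) (n : ℕ) (ω : ℕ → E) :
    visits D n ω = birkhoffSum shift (((fun ω : ℕ → E => ω 0) ⁻¹' D).indicator 1) n ω := by
  refine Finset.sum_congr rfl fun i _ => ?_
  have : shift^[i] ω 0 = ω i := by rw [shift_iterate_apply, zero_add]
  conv_lhs => rw [← this]
  rfl

theorem indicator_one_mem_Icc (D : Set E) (x : E) :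
    0 ≤ D.indicator (1 : E → ℝ) x ∧ D.indicator (1 : E → ℝ) x ≤ 1 :=
  ⟨Set.indicator_nonneg (fun _ _ => zero_le_one) _,
    Set.indicator_le' (fun _ _ => le_rfl) (fun _ _ => zero_le_one) x⟩

theorem visits_nonneg (D : Set E) (n : ℕ) (ω : ℕ → E) : 0 ≤ visits D n ω :=
  Finset.sum_nonneg fun i _ => (indicator_one_mem_Icc D (ω i)).1

theorem visits_le (D : Set E) (n : ℕ) (ω : ℕ → E) : visits D n ω ≤ n := by
  have := Finset.sum_le_sum fun i (_ : i ∈ Finset.range n) => (indicator_one_mem_Icc D (ω i)).2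
  simpa [visits] using this

theorem visits_succ' (D : Set E) (n : ℕ) (ω : ℕ → E) :
    visits D (n + 1) ω = visits D n (shift ω) + D.indicator 1 (ω 0) :=
  Finset.sum_range_succ' _ _

theorem eventually_mul_add_le {a b : ℝ} (hab : a < b) (e : ℝ) :
    ∀ᶠ n : ℕ in atTop, a * n + e ≤ b * n := by
  have h := tendsto_natCast_atTop_atTop (R := ℝ) |>.const_mul_atTop (sub_pos.2 hab)
  filter_upwards [h.eventually_ge_atTop e] with n hn
  linarith

/-- Dropping the first state changes the visit count by at most one; the gap between `q` and an
intermediate rational `r` absorbs this for large `n`. -/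
theorem shift_preimage_lowFrequency (D : Set E) (c : ℝ) :
    shift ⁻¹' lowFrequency D c = lowFrequency D c := by
  ext ω
  constructor
  · intro h q hq
    obtain ⟨r, hr, hrq⟩ := exists_rat_btwn hq
    rw [← map_add_atTop_eq_nat 1, eventually_map]
    filter_upwards [h r hr, eventually_mul_add_le hrq (1 - q)] with n h1 h2
    have h3 := (indicator_one_mem_Icc D (ω 0)).2
    rw [visits_succ']
    push_cast
    linarith
  · intro h q hq
    obtain ⟨r, hr, hrq⟩ := exists_rat_btwn hq
    have h1 := h r hr
    rw [← map_add_atTop_eq_nat 1, eventually_map] at h1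
    filter_upwards [h1, eventually_mul_add_le hrq r] with n h1 h2
    have h3 := (indicator_one_mem_Icc D (ω 0)).1
    rw [visits_succ'] at h1
    push_cast at h1
    linarith

variable [MeasurableSpace E]

theorem measurable_visits {D : Set E} (hD : MeasurableSet D) (n : ℕ) : Measurable (visits D n) :=
  Finset.measurable_sum _ fun i _ => (measurable_one.indicator hD).comp (measurable_pi_apply i)

theorem measurableSet_lowFrequency {D : Set E} (hD : MeasurableSet D) (c : ℝ) :
    MeasurableSet (lowFrequency D c) := by
  have : lowFrequency D c = ⋂ q : ℚ, ⋂ _ : c < q, ⋃ N : ℕ, ⋂ n : ℕ, ⋂ _ : N ≤ n,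
      {ω | visits D n ω ≤ q * n} := by
    ext ω
    simp [lowFrequency, eventually_atTop]
  rw [this]
  exact MeasurableSet.iInter fun q => MeasurableSet.iInter fun _ => MeasurableSet.iUnion fun N =>
    MeasurableSet.iInter fun n => MeasurableSet.iInter fun _ =>
      measurableSet_le (measurable_visits hD n) measurable_const

/-- An upper frequency above `c` forces some finite average above `c`, so the weak type maximal
inequality applies; pointwise convergence of averages is not required. -/
theorem mul_chainLaw_compl_lowFrequency_le (P : Kernel E E) [IsMarkovKernel P] {μ : Measure E}
    (hμ : IsInvariantProb P μ) {D : Set E} (hD : MeasurableSet D) {c : ℝ} (hc : 0 ≤ c) :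
    c * (chainLaw P μ).real (lowFrequency D c)ᶜ ≤ μ.real D := by
  have := hμ.1
  have h0 : Measurable fun ω : ℕ → E => ω 0 := measurable_pi_apply 0
  have h := mul_measureReal_frequency_gt_le (measurePreserving_shift P hμ) (h0 hD) hc
  have hμD : (chainLaw P μ).real ((fun ω : ℕ → E => ω 0) ⁻¹' D) = μ.real D := by
    rw [← map_measureReal_apply h0 hD, map_eval_zero_chainLaw]
  rw [hμD] at h
  refine le_trans (mul_le_mul_of_nonneg_left (measureReal_mono ?_) hc) h
  intro ω hω
  simp only [lowFrequency, Set.mem_compl_iff, Set.mem_ofPred_eq, not_forall,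
    not_eventually, not_le] at hω
  obtain ⟨q, hq, hfreq⟩ := hω
  obtain ⟨n, hn⟩ := hfreq.exists
  refine ⟨n, ?_⟩
  rw [← visits_eq_birkhoffSum]
  exact lt_of_le_of_lt (mul_le_mul_of_nonneg_right hq.le n.cast_nonneg) hn

/-- If almost every trajectory visits `D` with upper frequency at most `c`, so does the averaged
occupation probability. -/
theorem eventually_average_measureReal_le {Q : Measure (ℕ → E)} [IsProbabilityMeasure Q] {D : Set E}
    (hD : MeasurableSet D) {c b : ℝ} (hcb : c < b) (hQ : Q (lowFrequency D c)ᶜ = 0) :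
    ∀ᶠ n : ℕ in atTop, (1 / (n : ℝ)) * ∑ i ∈ Finset.range n, Q.real {ω | ω i ∈ D} ≤ b := by
  obtain ⟨q, hcq, hqb⟩ := exists_rat_btwn hcb
  have hmeas (n : ℕ) : Measurable fun ω : ℕ → E => (1 / (n : ℝ)) * visits D n ω :=
    (measurable_visits hD n).const_mul _
  have hnn (n : ℕ) (ω : ℕ → E) : 0 ≤ (1 / (n : ℝ)) * visits D n ω :=
    mul_nonneg (by positivity) (visits_nonneg D n ω)
  have hle (n : ℕ) (ω : ℕ → E) : (1 / (n : ℝ)) * visits D n ω ≤ 1 := by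
    rw [one_div_mul_eq_div]
    exact div_le_one_of_le₀ (visits_le D n ω) n.cast_nonneg
  have hint (n : ℕ) : Integrable (fun ω : ℕ → E => (1 / (n : ℝ)) * visits D n ω) Q := by
    refine Integrable.of_bound (hmeas n).aestronglyMeasurable 1 (ae_of_all _ fun ω => ?_)
    rw [Real.norm_of_nonneg (hnn n ω)]
    exact hle n ω
  -- Truncating from below at `q` turns the eventual bound by `q` into convergence to the constant
  -- `q`, so dominated convergence applies.
  have hlim : Tendsto (fun n : ℕ => ∫ ω, max ((1 / (n : ℝ)) * visits D n ω) q ∂Q) atTop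
      (nhds (∫ _, (q : ℝ) ∂Q)) := by
    refine tendsto_integral_of_dominated_convergence (fun _ => 1 + |(q : ℝ)|)
      (fun n => ((hmeas n).max measurable_const).aestronglyMeasurable) (integrable_const _)
      (fun n => ae_of_all _ fun ω => ?_) ?_
    · have h1 := hnn n ω
      have h2 := hle n ω
      have h3 := abs_nonneg (q : ℝ)
      rw [Real.norm_eq_abs, abs_of_nonneg (h1.trans (le_max_left _ _))]
      exact max_le (by linarith) (by linarith [le_abs_self (q : ℝ)])
    · filter_upwards [show ∀ᵐ ω ∂Q, ω ∈ lowFrequency D c from hQ] with ω hω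
      refine tendsto_const_nhds.congr' ?_
      filter_upwards [hω q hcq, eventually_gt_atTop 0] with n hn hpos
      rw [eq_comm, max_eq_right_iff, one_div_mul_eq_div, div_le_iff₀ (by exact_mod_cast hpos)]
      exact hn
  rw [integral_const, probReal_univ, one_smul] at hlim
  filter_upwards [hlim.eventually_lt_const hqb] with n hn
  have hsum : ∑ i ∈ Finset.range n, Q.real {ω : ℕ → E | ω i ∈ D} = ∫ ω, visits D n ω ∂Q := by
    unfold visits
    rw [integral_finsetSum _ fun i _ => ?_]
    · refine Finset.sum_congr rfl fun i _ => ?_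
      have hi : Measurable fun ω : ℕ → E => ω i := measurable_pi_apply i
      exact (integral_indicator_one (hi hD)).symm
    · have hi : Measurable fun ω : ℕ → E => ω i := measurable_pi_apply i
      exact (integrable_const (1 : ℝ)).indicator (hi hD)
  rw [hsum, ← integral_const_mul]
  refine le_trans (integral_mono (hint n) ((hint n).sup (integrable_const _)) fun ω => ?_) hn.le
  exact le_max_left _ _

/-- Almost every starting point of an invariant measure concentrated on `S` has trajectories which
spend almost all of their time in a compact subset of `S`. -/
theorem ae_exists_compact_lowFrequency [TopologicalSpace E] [PolishSpace E] [BorelSpace E]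
    (P : Kernel E E) [IsMarkovKernel P] {μ : Measure E} (hμ : IsInvariantProb P μ) {S : Set E}
    (hS : MeasurableSet S) (hμS : μ Sᶜ = 0) {c : ℝ} (hc : 0 < c) :
    ∀ᵐ x ∂μ, ∃ K ⊆ S, IsCompact K ∧ chainKernel P x (lowFrequency Kᶜ c)ᶜ = 0 := by
  have := hμ.1
  have hK (m : ℕ) : ∃ K ⊆ S, IsCompact K ∧ μ Kᶜ ≤ ((m : ENNReal) + 1)⁻¹ := by
    obtain ⟨K, hKS, hK, hlt⟩ := hS.exists_isCompact_sdiff_lt (μ := μ) (measure_ne_top _ _)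
      (ε := ((m : ENNReal) + 1)⁻¹) (by simp)
    refine ⟨K, hKS, hK, ?_⟩
    have : Kᶜ ⊆ (S \ K) ∪ Sᶜ := fun x hx => by
      by_cases h : x ∈ S
      · exact Or.inl ⟨h, hx⟩
      · exact Or.inr h
    refine (measure_mono this).trans ((measure_union_le _ _).trans ?_)
    rw [hμS, add_zero]
    exact hlt.le
  choose K hKS hKc hKμ using hK
  have hm (m : ℕ) : MeasurableSet (K m)ᶜ := (hKc m).isClosed.measurableSet.compl
  let A : ℕ → Set (ℕ → E) := fun m => (lowFrequency (K m)ᶜ c)ᶜ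
  have hA (m : ℕ) : MeasurableSet (A m) := (measurableSet_lowFrequency (hm m) c).compl
  have hinv (m : ℕ) : shift ⁻¹' A m = A m := by
    simp only [A]
    rw [Set.preimage_compl, shift_preimage_lowFrequency]
  have hzo := ae_all_iff.2 fun m => ae_chainKernel_eq_zero_or_one P hμ (hA m) (hinv m)
  -- The maximal inequality bounds the set of points bad for `K m` by `c⁻¹ / (m + 1)`, so almost no
  -- point is bad for all `m`; by the zero-one law, a point not bad for `m` gives `A m` probability
  -- zero.
  have hnull : μ {x | ∀ m, chainKernel P x (A m) = 1} = 0 := by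
    have hbound (m : ℕ) :
        μ.real {x | ∀ m, chainKernel P x (A m) = 1} ≤ c⁻¹ * (1 / ((m : ℝ) + 1)) := by
      have h1 := mul_chainLaw_compl_lowFrequency_le P hμ (hm m) hc.le
      have h2 : μ.real (K m)ᶜ ≤ 1 / ((m : ℝ) + 1) := by
        have := ENNReal.toReal_mono (by simp) (hKμ m)
        rwa [ENNReal.toReal_inv, ENNReal.toReal_add (by simp) (by simp), ENNReal.toReal_natCast,
          ENNReal.toReal_one, ← one_div] at this
      have h3 : μ {x | ∀ m, chainKernel P x (A m) = 1} ≤ chainLaw P μ (A m) := by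
        rw [chainLaw_apply P μ (hA m)]
        have hB : MeasurableSet {x | chainKernel P x (A m) = 1} :=
          Kernel.measurable_coe _ (hA m) (measurableSet_singleton 1)
        refine (measure_mono (t := {x | chainKernel P x (A m) = 1})
          fun x (hx : ∀ m, chainKernel P x (A m) = 1) => hx m).trans ?_
        rw [← lintegral_indicator_one hB]
        refine lintegral_mono (Set.indicator_le fun y hy => ?_)
        exact (show chainKernel P y (A m) = 1 from hy).ge
      have h4 : μ.real {x | ∀ m, chainKernel P x (A m) = 1} ≤ (chainLaw P μ).real (A m) :=
        ENNReal.toReal_mono (measure_ne_top _ _) h3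
      rw [← div_eq_inv_mul, le_div_iff₀ hc]
      calc _ ≤ (chainLaw P μ).real (A m) * c := mul_le_mul_of_nonneg_right h4 hc.le
        _ ≤ _ := by rw [mul_comm]; exact h1.trans h2
    have hlim := (tendsto_one_div_add_atTop_nhds_zero_nat (𝕜 := ℝ)).const_mul c⁻¹
    rw [mul_zero] at hlim
    exact (measureReal_eq_zero_iff).1 (le_antisymm (ge_of_tendsto' hlim hbound) measureReal_nonneg)
  filter_upwards [hzo, show ∀ᵐ x ∂μ, ¬ ∀ m, chainKernel P x (A m) = 1 by
    rw [ae_iff]; simpa only [not_not] using hnull] with x h1 h2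
  obtain ⟨m, hm⟩ := not_forall.1 h2
  exact ⟨K m, hKS m, hKc m, (h1 m).resolve_right hm⟩

end Frequency

/-! ### Separation of compacts and generalized couplings -/

section Uniqueness

variable {E : Type*}

theorem IsContinuousMetric.exists_pos_lt_of_disjoint [TopologicalSpace E] {d : E → E → ℝ}
    (hd : IsContinuousMetric d) {K L : Set E} (hK : IsCompact K) (hL : IsCompact L) (hKL : Disjoint K L) :
    ∃ ε > 0, ∀ x ∈ K, ∀ y ∈ L, ε < d x y := by
  obtain ⟨δ, hδ, h⟩ := (hK.prod hL).exists_forall_le' hd.continuous.continuousOn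
    (a := 0) (fun p hp => lt_of_le_of_ne (hd.nonneg _ _) fun h =>
      Set.disjoint_left.1 hKL hp.1 (((hd.eq_zero_iff _ _).1 h.symm) ▸ hp.2))
  -- Halving the lower bound `δ` makes the separation strict.
  exact ⟨δ / 2, half_pos hδ, fun x hx y hy =>
    lt_of_lt_of_le (half_lt_self hδ) (h (x, y) ⟨hx, hy⟩)⟩

/-- A generalized coupling of two chains which spend almost all of their time in two sets at
distance greater than `ε` is rarely within distance `ε`. -/
theorem limsup_average_coupling_le [MeasurableSpace E] {Q R : Measure (ℕ → E)}
    {ξ : Measure ((ℕ → E) × (ℕ → E))} (hξ : ξ ∈ generalizedCouplings Q R)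
    {K L : Set E} (hK : MeasurableSet K) (hL : MeasurableSet L) {d : E → E → ℝ} {ε : ℝ}
    (hKL : ∀ x ∈ K, ∀ y ∈ L, ε < d x y) {c b : ℝ} (hcb : c < b)
    (hQ : Q (lowFrequency Kᶜ c)ᶜ = 0) (hR : R (lowFrequency Lᶜ c)ᶜ = 0) :
    limsup (fun n : ℕ => (1 / (n : ℝ)) * ∑ i ∈ Finset.range n,
      ξ.real {ω : (ℕ → E) × (ℕ → E) | d (ω.1 i) (ω.2 i) ≤ ε}) atTop ≤ 2 * b := by
  obtain ⟨hprob, hfst, hsnd⟩ := hξ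
  have := Measure.isProbabilityMeasure_map (μ := ξ) measurable_fst.aemeasurable
  have := Measure.isProbabilityMeasure_map (μ := ξ) measurable_snd.aemeasurable
  refine limsup_le_of_le ?_ ?_
  · refine isCoboundedUnder_le_of_le atTop (x := 0) fun n => ?_
    exact mul_nonneg (by positivity) (Finset.sum_nonneg fun i _ => measureReal_nonneg)
  -- Absolute continuity enters only here: it carries the null sets `hQ` and `hR` over to the
  -- marginals of `ξ`.
  filter_upwards [eventually_average_measureReal_le hK.compl hcb (hfst hQ),
    eventually_average_measureReal_le hL.compl hcb (hsnd hR)] with n h1 h2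
  have hterm (i : ℕ) : ξ.real {ω : (ℕ → E) × (ℕ → E) | d (ω.1 i) (ω.2 i) ≤ ε} ≤
      (ξ.map Prod.fst).real {ω | ω i ∈ Kᶜ} + (ξ.map Prod.snd).real {ω | ω i ∈ Lᶜ} := by
    have hi : Measurable fun ω : ℕ → E => ω i := measurable_pi_apply i
    have e1 := map_measureReal_apply (μ := ξ) measurable_fst (hi hK.compl)
    have e2 := map_measureReal_apply (μ := ξ) measurable_snd (hi hL.compl)
    refine le_trans ?_ (add_le_add e1.ge e2.ge)
    refine le_trans (measureReal_mono fun ω hω => ?_) (measureReal_union_le _ _)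
    by_contra hcon
    simp only [Set.mem_union, not_or] at hcon
    exact absurd hω (not_le.2 (hKL _ (not_not.1 hcon.1) _ (not_not.1 hcon.2)))
  calc _ ≤ (1 / (n : ℝ)) * ∑ i ∈ Finset.range n, ((ξ.map Prod.fst).real {ω | ω i ∈ Kᶜ} +
        (ξ.map Prod.snd).real {ω | ω i ∈ Lᶜ}) :=
        mul_le_mul_of_nonneg_left (Finset.sum_le_sum fun i _ => hterm i) (by positivity)
    _ ≤ 2 * b := by rw [Finset.sum_add_distrib, mul_add]; linarith

end Uniqueness

/-! ### Uniqueness and ergodicity -/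

theorem invariantProb_unique {E : Type*} [TopologicalSpace E] [PolishSpace E] [MeasurableSpace E]
    [BorelSpace E] (P : Kernel E E) [IsMarkovKernel P]
    (d : E → E → ℝ) (hd : IsContinuousMetric d)
    (M : Set E) (hMpos : ∀ μ : Measure E, IsInvariantProb P μ → 0 < μ M)
    (hcoupling : ∀ x ∈ M, ∀ y ∈ M, ∃ α : ℝ, 0 < α ∧ ∀ ε : ℝ, 0 < ε →
      ∃ ξ ∈ generalizedCouplings (chainLaw P (Measure.dirac x)) (chainLaw P (Measure.dirac y)),
        α ≤ limsup (fun n : ℕ => (1 / (n : ℝ)) *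
          ∑ i ∈ Finset.range n,
            ξ.real {ω : (ℕ → E) × (ℕ → E) | d (ω.1 i) (ω.2 i) ≤ ε}) atTop)
    {μ ν : Measure E} (hμ : IsInvariantProb P μ) (hν : IsInvariantProb P ν) : μ = ν := by
  by_contra hne
  obtain ⟨σ, ρ₂, H, hσ, hρ₂, hH, hμH, hνH⟩ := exists_mutuallySingular_invariant hμ hν hne
  have hpos (k : ℕ) : (0 : ℝ) < 1 / ((k : ℝ) + 1) := by positivity
  -- The starting points must work for all thresholds `1 / (k + 1)` at once, since `α` depends on
  -- them and is known only afterwards.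
  have hgood {ρ : Measure E} (hρ : IsInvariantProb P ρ) {S : Set E} (hS : MeasurableSet S)
      (hρS : ρ Sᶜ = 0) : ∃ x ∈ M, ∀ k : ℕ, ∃ K ⊆ S, IsCompact K ∧
        chainKernel P x (lowFrequency Kᶜ (1 / ((k : ℝ) + 1)))ᶜ = 0 := by
    have hae := ae_all_iff.2 fun k : ℕ => ae_exists_compact_lowFrequency P hρ hS hρS (hpos k)
    have hfreq : ∃ᵐ x ∂ρ, x ∈ M := frequently_ae_mem_iff.2 (hMpos ρ hρ).ne'
    exact (hfreq.and_eventually hae).exists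
  obtain ⟨x, hxM, hx⟩ := hgood hσ hH hμH
  obtain ⟨y, hyM, hy⟩ := hgood hρ₂ hH.compl (by rwa [compl_compl])
  obtain ⟨α, hα, hξ⟩ := hcoupling x hxM y hyM
  -- With `b = α / 4`, the coupling bound `2 * b` is `α / 2 < α`.
  obtain ⟨k, hk⟩ := exists_nat_one_div_lt (show (0 : ℝ) < α / 4 by positivity)
  obtain ⟨K, hKH, hK, hxK⟩ := hx k
  obtain ⟨L, hLH, hL, hyL⟩ := hy k
  obtain ⟨ε, hε, hsep⟩ := hd.exists_pos_lt_of_disjoint hK hL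
    (Set.disjoint_of_subset hKH hLH disjoint_compl_right)
  obtain ⟨ξ, hξmem, hξα⟩ := hξ ε hε
  rw [chainLaw_dirac, chainLaw_dirac] at hξmem
  have := limsup_average_coupling_le hξmem hK.isClosed.measurableSet hL.isClosed.measurableSet
    hsep hk hxK hyL
  linarith

theorem ergodic_shift_of_invariantProb_unique {E : Type*} [MeasurableSpace E] (P : Kernel E E)
    [IsMarkovKernel P]
    (huniq : ∀ μ ν : Measure E, IsInvariantProb P μ → IsInvariantProb P ν → μ = ν)
    {μ : Measure E} (hμ : IsInvariantProb P μ) : Ergodic shift (chainLaw P μ) := by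
  have := hμ.1
  refine ⟨measurePreserving_shift P hμ, ⟨fun A hA hinv => ?_⟩⟩
  have hone (h0 : μ {x | chainKernel P x A = 1} ≠ 0) : chainLaw P μ Aᶜ = 0 := by
    have hB : MeasurableSet {x | chainKernel P x A = 1} :=
      Kernel.measurable_coe _ hA (measurableSet_singleton 1)
    have hne : μ.restrict {x | chainKernel P x A = 1} ≠ 0 := by
      rwa [Ne, Measure.restrict_eq_zero]
    have heq := huniq _ _ hμ
      (isInvariantProb_normalize hne (invariant_restrict_chainKernel_eq_one P hμ hA hinv))
    -- By uniqueness `μ` equals its own normalised restriction, so it does not charge the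
    -- complement.
    have hnull : μ {x | chainKernel P x A = 1}ᶜ = 0 := by
      rw [heq, Measure.smul_apply, Measure.restrict_apply hB.compl]
      simp
    rw [chainLaw_apply P μ hA.compl, lintegral_eq_zero_iff (Kernel.measurable_coe _ hA.compl)]
    filter_upwards [show ∀ᵐ x ∂μ, x ∈ {x | chainKernel P x A = 1} from hnull] with x hx
    exact (prob_compl_eq_zero_iff hA).2 hx
  rw [eventuallyConst_set']
  by_cases h : μ {x | chainKernel P x A = 1} = 0
  · left
    refine ae_eq_empty.2 ?_
    rw [chainLaw_apply P μ hA, lintegral_eq_zero_iff (Kernel.measurable_coe _ hA)]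
    filter_upwards [ae_chainKernel_eq_zero_or_one P hμ hA hinv,
      show ∀ᵐ x ∂μ, ¬ chainKernel P x A = 1 by rw [ae_iff]; simpa only [not_not] using h]
      with x h1 h2 using h1.resolve_right h2
  · right
    exact ae_eq_univ.2 (hone h)

end GenCoupling

theorem corollary2p2 {E : Type*} [TopologicalSpace E] [PolishSpace E] [MeasurableSpace E]
    [BorelSpace E] (P : Kernel E E) [IsMarkovKernel P]
    (d : E → E → ℝ) (hd : GenCoupling.IsContinuousMetric d)
    (M : Set E) (hM : MeasurableSet M)
    (hMpos : ∀ μ : Measure E, GenCoupling.IsInvariantProb P μ → 0 < μ M)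
    (hcoupling : ∀ x ∈ M, ∀ y ∈ M, ∃ α : ℝ, 0 < α ∧ ∀ ε : ℝ, 0 < ε →
      ∃ ξ ∈ GenCoupling.generalizedCouplings
          (GenCoupling.chainLaw P (Measure.dirac x)) (GenCoupling.chainLaw P (Measure.dirac y)),
        α ≤ limsup (fun n : ℕ => (1 / (n : ℝ)) *
          ∑ i ∈ Finset.range n,
            ξ.real {ω : (ℕ → E) × (ℕ → E) | d (ω.1 i) (ω.2 i) ≤ ε}) atTop) :
    (∀ μ ν : Measure E, GenCoupling.IsInvariantProb P μ → GenCoupling.IsInvariantProb P ν →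
      μ = ν) ∧
    (∀ μ : Measure E, GenCoupling.IsInvariantProb P μ →
      Ergodic GenCoupling.shift (GenCoupling.chainLaw P μ)) := by
  have huniq : ∀ μ ν : Measure E, GenCoupling.IsInvariantProb P μ →
      GenCoupling.IsInvariantProb P ν → μ = ν := fun _ _ hμ hν =>
    GenCoupling.invariantProb_unique P d hd M hMpos hcoupling hμ hν
  exact ⟨huniq, fun _ hμ =>
    GenCoupling.ergodic_shift_of_invariantProb_unique P huniq hμ⟩
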